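/- Let $k$ be a field with $\mathrm{char}(k)\neq 2,3$, and let $L=L_{\bar 0}\oplus L_{\bar 1}$ be a Lie superalgebra over $k$, that is, a $\mathbb{Z}/2$-graded vector space with a bilinear bracket such that, for all $a,b,c\in\mathbb{Z}/2$ and $x\in L_a$, $y\in L_b$, $z\in L_c$, one has $[x,y]\in L_{a+b}$, $[x,y]=-(-1)^{ab}[y,x]$ and $[x,[y,z]]=[[x,y],z]+(-1)^{ab}[y,[x,z]]$. Let $\mathcal{U}(L)$ be its universal enveloping algebra, that is, the quotient of the tensor algebra $T(L)$ by the two-sided ideal generated by all $xy-(-1)^{ab}yx-[x,y]$ with $x\in L_a$, $y\in L_b$, $a,b\in\mathbb{Z}/2$. Let $(z_i)_{i\in I}$ be a linear basis of $L$, indexed by a totally ordered set $I$ (for instance $z_1,z_2,\dots$), such that each $z_i$ lies in $L_{\bar 0}$ or in $L_{\bar 1}$. Then the monomials $z_{i_1}z_{i_2}\cdots z_{i_n}$ in $\mathcal{U}(L)$, where $n\ge 0$ (the empty monomial being $1$) and, for $1\le m<n$, $i_m\le i_{m+1}$, with $i_m\neq i_{m+1}$ if $z_{i_m}\in L_{\bar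 1}$, form a linear basis of $\mathcal{U}(L)$; that is, distinct index sequences of this kind give distinct elements, and these elements form a basis. -/

import Mathlib

/-- The sign `(-1) ^ (a * b)` in `k` attached to two parities `a b : ZMod 2`. -/
def superSign (k : Type*) [Field k] (a b : ZMod 2) : k :=
  (-1) ^ (a.val * b.val)

/-- A Lie superalgebra structure on a `k`-vector space `L` (for `k` of characteristic different
from 2 and 3): a grading of `L` by `ZMod 2` and an even bilinear bracket that satisfies
super skew-symmetry and the super Jacobi identity. -/
class LieSuperalgebra (k : Type*) (L : Type*) [Field k] [AddCommGroup L] [Module k L] where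
  /-- the even part `part 0` and the odd part `part 1` -/
  part : ZMod 2 → Submodule k L
  /-- `L` is the internal direct sum of its even and its odd part -/
  isInternal : DirectSum.IsInternal part
  /-- the superbracket -/
  bracket : L →ₗ[k] L →ₗ[k] L
  bracket_mem : ∀ (a b : ZMod 2) (x y : L), x ∈ part a → y ∈ part b →
    bracket x y ∈ part (a + b)
  bracket_skew : ∀ (a b : ZMod 2) (x y : L), x ∈ part a → y ∈ part b →
    bracket x y = -(superSign k a b • bracket y x)
  jacobi : ∀ (a b c : ZMod 2) (x y z : L), x ∈ part a → y ∈ part b → z ∈ part c →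
    bracket x (bracket y z) =
      bracket (bracket x y) z + superSign k a b • bracket y (bracket x z)

namespace LieSuperalgebra

/-- The relations `x y - (-1) ^ (a b) y x = [x, y]`, for `x`, `y` homogeneous of parities `a`, `b`,
on the tensor algebra of `L`. -/
inductive EnvelopingRel (k : Type*) (L : Type*) [Field k] [AddCommGroup L] [Module k L]
    [LieSuperalgebra k L] : TensorAlgebra k L → TensorAlgebra k L → Prop
  | of (a b : ZMod 2) (x y : L) (hx : x ∈ part (k := k) a) (hy : y ∈ part (k := k) b) :
      EnvelopingRel k L
        (TensorAlgebra.ι k x * TensorAlgebra.ι k y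
          - superSign k a b • (TensorAlgebra.ι k y * TensorAlgebra.ι k x))
        (TensorAlgebra.ι k (bracket (k := k) x y))

/-- The universal enveloping algebra of a Lie superalgebra: the quotient of the tensor algebra
by the two-sided ideal generated by the relations `EnvelopingRel`. -/
abbrev Enveloping (k : Type*) (L : Type*) [Field k] [AddCommGroup L] [Module k L]
    [LieSuperalgebra k L] : Type _ :=
  RingQuot (EnvelopingRel k L)

/-- The canonical linear map from a Lie superalgebra to its universal enveloping algebra. -/
noncomputable def toEnveloping (k : Type*) (L : Type*) [Field k] [AddCommGroup L] [Module k L]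
    [LieSuperalgebra k L] : L →ₗ[k] Enveloping k L :=
  (RingQuot.mkAlgHom k (EnvelopingRel k L)).toLinearMap ∘ₗ TensorAlgebra.ι k

/-- A word `i₁ i₂ ⋯ iₙ` in the index set of a basis `z` (the empty word included) is admissible if
any two neighbours satisfy `iₖ ≤ iₖ₊₁`, with `iₖ ≠ iₖ₊₁` when `z iₖ` is odd. -/
def IsAdmissible {k L ι : Type*} [Field k] [AddCommGroup L] [Module k L] [LieSuperalgebra k L]
    [LinearOrder ι] (z : Module.Basis ι k L) (w : List ι) : Prop :=
  w.IsChain fun i j => i ≤ j ∧ (z i ∈ part (k := k) (L := L) 1 → i ≠ j)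

end LieSuperalgebra

/-! The monomials span because the relations sort letters up to shorter words, and an odd square is
half a bracket. Independence comes from a representation: `L` acts on the free vector space on
admissible words by the rules of this sorting. A letter is put in front when the result is
admissible. Otherwise it is moved past a smaller first letter at the cost of a bracket, or, if it is
odd and equals the first letter, the two are replaced by half of their bracket.

The recursion is well founded because, for `l < i` and `l w` admissible, `z i` sends `w` to words
that accept `l` in front plus words no longer than `w` (`actionFuel_mem_leading`). The heart is
`defect_eq_zero`: the action respects the superbracket. By induction on length, the first letter is
pulled out of the word and the Jacobi identity applied; repeated odd letters need division by 2, and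
a cube needs `[y,[y,y]] = 0`, hence characteristic different from 3.

The action therefore extends to the enveloping algebra. Applied to the empty word, a monomial
returns its own word, so `monomialMap` is injective. It also intertwines the action with left
multiplication (`monomialMap_action`), so its range is a left ideal containing `1`. -/

namespace LieSuperalgebra

open Finsupp

/-! ### Signs, parities and reduction to basis vectors -/

section Signs

variable {k : Type*} [Field k]

theorem superSign_zero_left (b : ZMod 2) : superSign k 0 b = 1 := by simp [superSign]

theorem superSign_zero_right (a : ZMod 2) : superSign k a 0 = 1 := by simp [superSign]

theorem superSign_one_one : superSign k 1 1 = -1 := by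
  simp [superSign, ZMod.val_one]

theorem parity_cases (a : ZMod 2) : a = 0 ∨ a = 1 := by
  revert a; decide

theorem one_add_one_parity : (1 + 1 : ZMod 2) = 0 := by decide

theorem three_ne_zero_of_ringChar (hk3 : ringChar k ≠ 3) : (3 : k) ≠ 0 := by
  intro h
  have h3 : ringChar k ∣ 3 := ringChar.dvd (by exact_mod_cast h)
  rcases (Nat.dvd_prime Nat.prime_three).1 h3 with h1 | h1
  · exact CharP.ringChar_ne_one h1
  · exact hk3 h1

end Signs

section Basis

variable {k L ι : Type*} [Field k] [AddCommGroup L] [Module k L] {z : Module.Basis ι k L}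

/-- A property of vectors of `L` that defines a subspace holds if it holds for basis vectors. -/
theorem mem_of_basis_mem {N : Submodule k L} (h : ∀ i, z i ∈ N) (x : L) : x ∈ N := by
  have : (⊤ : Submodule k L) ≤ N := by
    rw [← z.span_eq, Submodule.span_le]
    rintro _ ⟨i, rfl⟩
    exact h i
  exact this trivial

theorem apply_mem_of_basis {M : Type*} [AddCommGroup M] [Module k M] {N : Submodule k M}
    (f : L →ₗ[k] M) (h : ∀ i, f (z i) ∈ N) (x : L) : f x ∈ N :=
  mem_of_basis_mem (z := z) (N := N.comap f) h x

end Basis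

/-! ### The recursive action on admissible words -/

section Action

variable {k L ι : Type*} [Field k] [AddCommGroup L] [Module k L] [LieSuperalgebra k L]
  [LinearOrder ι]

open Classical in
/-- The parity of a homogeneous basis vector. -/
noncomputable def parity (z : Module.Basis ι k L) (i : ι) : ZMod 2 :=
  if z i ∈ part (k := k) (L := L) 1 then 1 else 0

/-- The admissible words. -/
abbrev Word (z : Module.Basis ι k L) : Type _ := {w : List ι // IsAdmissible z w}

/-- The tail of a nonempty admissible word is admissible. -/
theorem IsAdmissible.tail {z : Module.Basis ι k L} {i : ι} {w : List ι}
    (h : IsAdmissible z (i :: w)) : IsAdmissible z w :=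
  List.IsChain.tail h

open Classical in
/-- Approximations of the action of `L` on the space spanned by the admissible words; the `n`-th
one is correct on the words of length at most `n`. -/
noncomputable def actionFuel (z : Module.Basis ι k L) :
    ℕ → L →ₗ[k] (Word z →₀ k) →ₗ[k] (Word z →₀ k)
  | 0 => z.constr k fun i => linearCombination k fun w : Word z =>
      if h : IsAdmissible z (i :: w.1) then single ⟨i :: w.1, h⟩ 1 else 0
  | n + 1 => z.constr k fun i => linearCombination k fun w : Word z =>
      if h : IsAdmissible z (i :: w.1) then single ⟨i :: w.1, h⟩ 1 else
        match w with
        -- Never reached: one-letter words are admissible.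
        | ⟨[], _⟩ => 0
        | ⟨j :: u, hu⟩ =>
          -- Here `z i` is odd, since an even letter may be repeated; the factor 1/2 reflects `2 (z
          -- i)² = [z i, z i]`.
          if i = j then
            (1 / 2 : k) • actionFuel z n (bracket (k := k) (z i) (z i)) (single ⟨u, hu.tail⟩ 1)
          else
            superSign k (parity z i) (parity z j) •
                actionFuel z n (z j) (actionFuel z n (z i) (single ⟨u, hu.tail⟩ 1)) +
              actionFuel z n (bracket (k := k) (z i) (z j)) (single ⟨u, hu.tail⟩ 1)

variable {z : Module.Basis ι k L}

theorem actionFuel_of_isAdmissible (n : ℕ) {i : ι} {w : List ι} (hw : IsAdmissible z w)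
    (h : IsAdmissible z (i :: w)) :
    actionFuel z n (z i) (single ⟨w, hw⟩ 1) = single ⟨i :: w, h⟩ 1 := by
  cases n <;> simp [actionFuel, Module.Basis.constr_basis, h]

theorem not_isAdmissible_self {i : ι} {w : List ι} (hi : parity z i = 1) :
    ¬ IsAdmissible z (i :: i :: w) := by
  intro h
  have h1 : z i ∈ part (k := k) (L := L) 1 := by
    by_contra hc
    simp [parity, hc] at hi
  exact (List.isChain_cons_cons.1 h).1.2 h1 rfl

theorem not_isAdmissible_of_lt {i j : ι} {w : List ι} (hij : j < i) :
    ¬ IsAdmissible z (i :: j :: w) :=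
  fun h => absurd (List.isChain_cons_cons.1 h).1.1 (not_le.2 hij)

theorem isAdmissible_cons_cons_of_lt {i j : ι} {w : List ι} (hij : i < j)
    (h : IsAdmissible z (j :: w)) : IsAdmissible z (i :: j :: w) :=
  List.isChain_cons_cons.2 ⟨⟨hij.le, fun _ => hij.ne⟩, h⟩

/-- Admissibility of a word with at least two letters only depends on the first two letters and
on the admissibility of the tail. -/
theorem IsAdmissible.replace {i j : ι} {v w : List ι} (h : IsAdmissible z (i :: j :: w))
    (hv : IsAdmissible z (j :: v)) : IsAdmissible z (i :: j :: v) :=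
  List.isChain_cons_cons.2 ⟨(List.isChain_cons_cons.1 h).1, hv⟩

variable (z) in
theorem isAdmissible_nil : IsAdmissible z [] :=
  List.isChain_nil

theorem isAdmissible_singleton (i : ι) : IsAdmissible z [i] :=
  List.isChain_singleton i

theorem lt_or_eq_of_not_isAdmissible {i j : ι} {w : List ι} (hw : IsAdmissible z (j :: w))
    (h : ¬ IsAdmissible z (i :: j :: w)) : j < i ∨ (i = j ∧ parity z i = 1) := by
  by_contra hc
  push Not at hc
  refine h (List.isChain_cons_cons.2 ⟨⟨hc.1, fun h1 h2 => hc.2 h2 ?_⟩, hw⟩)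
  simp [parity, h1]

theorem actionFuel_succ_self (n : ℕ) {i : ι} {w : List ι} (hw : IsAdmissible z (i :: w))
    (hi : parity z i = 1) :
    actionFuel z (n + 1) (z i) (single ⟨i :: w, hw⟩ 1) =
      (1 / 2 : k) • actionFuel z n (bracket (k := k) (z i) (z i)) (single ⟨w, hw.tail⟩ 1) := by
  simp [actionFuel, Module.Basis.constr_basis, not_isAdmissible_self hi]

theorem actionFuel_succ_of_lt (n : ℕ) {i j : ι} {w : List ι} (hw : IsAdmissible z (j :: w))
    (hij : j < i) :
    actionFuel z (n + 1) (z i) (single ⟨j :: w, hw⟩ 1) =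
      superSign k (parity z i) (parity z j) •
          actionFuel z n (z j) (actionFuel z n (z i) (single ⟨w, hw.tail⟩ 1)) +
        actionFuel z n (bracket (k := k) (z i) (z j)) (single ⟨w, hw.tail⟩ 1) := by
  simp [actionFuel, Module.Basis.constr_basis, not_isAdmissible_of_lt hij, hij.ne']

theorem actionFuel_zero_of_not {i : ι} {w : List ι} (hw : IsAdmissible z w)
    (h : ¬ IsAdmissible z (i :: w)) :
    actionFuel z 0 (z i) (single ⟨w, hw⟩ 1) = 0 := by
  simp [actionFuel, Module.Basis.constr_basis, h]

/-! ### Length estimates and independence of the fuel -/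

variable (z) in
/-- The span of the admissible words of length at most `n`. -/
noncomputable def lengthLE (n : ℕ) : Submodule k (Word z →₀ k) :=
  supported k k {w | w.1.length ≤ n}

variable (z) in
/-- The span of the admissible words that stay admissible when `l` is put in front, and those of
length at most `n`. -/
noncomputable def leading (l : ι) (n : ℕ) : Submodule k (Word z →₀ k) :=
  supported k k {w | IsAdmissible z (l :: w.1) ∨ w.1.length ≤ n}

theorem single_mem_lengthLE {n : ℕ} {w : List ι} (hw : IsAdmissible z w) (h : w.length ≤ n) :
    single (⟨w, hw⟩ : Word z) (1 : k) ∈ lengthLE z n :=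
  single_mem_supported k 1 h

theorem lengthLE_le {n : ℕ} {N : Submodule k (Word z →₀ k)}
    (h : ∀ (w : List ι) (hw : IsAdmissible z w), w.length ≤ n → single ⟨w, hw⟩ 1 ∈ N) :
    lengthLE z n ≤ N := by
  rw [lengthLE, supported_eq_span_single, Submodule.span_le]
  rintro _ ⟨w, hw, rfl⟩
  exact h w.1 w.2 hw

theorem leading_le {l : ι} {n : ℕ} {N : Submodule k (Word z →₀ k)}
    (h : ∀ (w : List ι) (hw : IsAdmissible z w), IsAdmissible z (l :: w) → single ⟨w, hw⟩ 1 ∈ N)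
    (h' : lengthLE z n ≤ N) :
    leading z l n ≤ N := by
  rw [leading, supported_eq_span_single, Submodule.span_le]
  rintro _ ⟨w, hw | hw, rfl⟩
  · exact h w.1 w.2 hw
  · exact h' (single_mem_lengthLE w.2 hw)

theorem lengthLE_mono {m n : ℕ} (h : m ≤ n) : lengthLE z m ≤ lengthLE z n :=
  supported_mono fun _ hw => le_trans hw h

theorem lengthLE_le_leading (l : ι) (n : ℕ) : lengthLE z n ≤ leading z l n :=
  supported_mono fun _ hw => Or.inr hw

theorem single_mem_leading {l : ι} {n : ℕ} {w : List ι} (hw : IsAdmissible z w)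
    (h : IsAdmissible z (l :: w)) : single (⟨w, hw⟩ : Word z) (1 : k) ∈ leading z l n :=
  single_mem_supported k 1 (Or.inl h)

theorem actionFuel_mem_lengthLE (n : ℕ) : ∀ (m : ℕ) (x : L) (v : Word z →₀ k),
    v ∈ lengthLE z m → actionFuel z n x v ∈ lengthLE z (m + 1) := by
  induction n with
  | zero =>
    intro m x v hv
    refine apply_mem_of_basis (z := z) ((actionFuel z 0).flip v) (fun i => ?_) x
    refine lengthLE_le (N := (lengthLE z (m + 1)).comap (actionFuel z 0 (z i))) ?_ hv
    intro w hw hm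
    rw [Submodule.mem_comap]
    by_cases h : IsAdmissible z (i :: w)
    · rw [actionFuel_of_isAdmissible _ _ h]
      exact single_mem_lengthLE _ (by simpa using hm)
    · rw [actionFuel_zero_of_not hw h]
      exact zero_mem _
  | succ n ih =>
    intro m x v hv
    refine apply_mem_of_basis (z := z) ((actionFuel z (n + 1)).flip v) (fun i => ?_) x
    refine lengthLE_le (N := (lengthLE z (m + 1)).comap (actionFuel z (n + 1) (z i))) ?_ hv
    intro w hw hm
    rw [Submodule.mem_comap]
    by_cases h : IsAdmissible z (i :: w)
    · rw [actionFuel_of_isAdmissible _ _ h]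
      exact single_mem_lengthLE _ (by simpa using hm)
    · match w, hw, h, hm with
      | [], _, h, _ => exact absurd (isAdmissible_singleton i) h
      | j :: u, hu, h, hm =>
        obtain ⟨m, rfl⟩ : ∃ m', m = m' + 1 := ⟨m - 1, by simp at hm; omega⟩
        have hm' : u.length ≤ m := by simpa using hm
        have hmem := single_mem_lengthLE (k := k) hu.tail hm'
        rcases lt_or_eq_of_not_isAdmissible hu h with hij | ⟨rfl, hi⟩
        · rw [actionFuel_succ_of_lt n hu hij]
          exact add_mem (Submodule.smul_mem _ _ (ih _ _ _ (ih _ _ _ hmem)))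
            (lengthLE_mono (Nat.le_succ _) (ih _ _ _ hmem))
        · rw [actionFuel_succ_self n hu hi]
          exact Submodule.smul_mem _ _ (lengthLE_mono (Nat.le_succ _) (ih _ _ _ hmem))

/-- Sorting a letter larger than `l` into `w` leaves the top-length words with a first letter that
`l` may precede; brackets only produce words of length at most that of `w`. This makes the nested
recursive call harmless. -/
theorem actionFuel_mem_leading (n : ℕ) : ∀ {i l : ι} {w : List ι} (hw : IsAdmissible z w),
    IsAdmissible z (l :: w) → l < i →
      actionFuel z n (z i) (single ⟨w, hw⟩ 1) ∈ leading z l w.length := by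
  induction n with
  | zero =>
    intro i l w hw hl hli
    by_cases h : IsAdmissible z (i :: w)
    · rw [actionFuel_of_isAdmissible _ _ h]
      exact single_mem_leading _ (isAdmissible_cons_cons_of_lt hli h)
    · rw [actionFuel_zero_of_not hw h]
      exact zero_mem _
  | succ n ih =>
    intro i l w hw hl hli
    by_cases h : IsAdmissible z (i :: w)
    · rw [actionFuel_of_isAdmissible _ _ h]
      exact single_mem_leading _ (isAdmissible_cons_cons_of_lt hli h)
    · match w, hw, h, hl with
      | [], _, h, _ => exact absurd (isAdmissible_singleton i) h
      | j :: u, hu, h, hl =>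
        have hmem := single_mem_lengthLE (k := k) hu.tail le_rfl
        have hbr (x : L) : actionFuel z n x (single ⟨u, hu.tail⟩ 1) ∈
            leading z l (j :: u).length :=
          lengthLE_le_leading _ _ (actionFuel_mem_lengthLE n _ _ _ hmem)
        rcases lt_or_eq_of_not_isAdmissible hu h with hij | ⟨rfl, hi⟩
        · rw [actionFuel_succ_of_lt n hu hij]
          refine add_mem (Submodule.smul_mem _ _ ?_) (hbr _)
          refine leading_le (N := (leading z l (j :: u).length).comap (actionFuel z n (z j)))
            ?_ ?_ (ih hu.tail hu hij)
          · intro v hv hjv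
            rw [Submodule.mem_comap, actionFuel_of_isAdmissible _ _ hjv]
            exact single_mem_leading _ (hl.replace hjv)
          · exact fun v hv => lengthLE_le_leading _ _ (actionFuel_mem_lengthLE n _ _ _ hv)
        · rw [actionFuel_succ_self n hu hi]
          exact Submodule.smul_mem _ _ (hbr _)

/-- The only danger is the outer call in the swap rule, whose argument may exceed length `n`. By
`actionFuel_mem_leading`, its words either accept the letter in front, where the fuel plays no role,
or are short enough for induction. -/
theorem actionFuel_succ_eq (n : ℕ) : ∀ (x : L) (v : Word z →₀ k),
    v ∈ lengthLE z n → actionFuel z (n + 1) x v = actionFuel z n x v := by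
  have key (n : ℕ) (h : ∀ (i : ι) (w : List ι) (hw : IsAdmissible z w), w.length ≤ n →
      actionFuel z (n + 1) (z i) (single ⟨w, hw⟩ 1) = actionFuel z n (z i) (single ⟨w, hw⟩ 1))
      (x : L) (v : Word z →₀ k) (hv : v ∈ lengthLE z n) :
      actionFuel z (n + 1) x v = actionFuel z n x v := by
    refine mem_of_basis_mem (z := z)
      (N := LinearMap.eqLocus ((actionFuel z (n + 1)).flip v) ((actionFuel z n).flip v))
      (fun i => ?_) x
    exact lengthLE_le (N := LinearMap.eqLocus (actionFuel z (n + 1) (z i)) (actionFuel z n (z i)))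
      (h i) hv
  induction n with
  | zero =>
    refine key 0 fun i w hw hn => ?_
    obtain rfl : w = [] := by simpa using hn
    rw [actionFuel_of_isAdmissible _ _ (isAdmissible_singleton i),
      actionFuel_of_isAdmissible _ _ (isAdmissible_singleton i)]
  | succ n ih =>
    refine key (n + 1) fun i w hw hn => ?_
    by_cases h : IsAdmissible z (i :: w)
    · rw [actionFuel_of_isAdmissible _ _ h, actionFuel_of_isAdmissible _ _ h]
    · match w, hw, h, hn with
      | [], _, h, _ => exact absurd (isAdmissible_singleton i) h
      | j :: u, hu, h, hn =>
        have hn' : u.length ≤ n := by simpa using hn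
        have hmem := single_mem_lengthLE (k := k) hu.tail hn'
        rcases lt_or_eq_of_not_isAdmissible hu h with hij | ⟨rfl, hi⟩
        · rw [actionFuel_succ_of_lt (n + 1) hu hij, actionFuel_succ_of_lt n hu hij, ih _ _ hmem,
            ih _ _ hmem]
          congr 2
          refine leading_le
            (N := LinearMap.eqLocus (actionFuel z (n + 1) (z j)) (actionFuel z n (z j)))
            ?_ ?_ (actionFuel_mem_leading n hu.tail hu hij)
          · intro v hv hjv
            rw [LinearMap.mem_eqLocus, actionFuel_of_isAdmissible _ _ hjv,
              actionFuel_of_isAdmissible _ _ hjv]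
          · exact fun v hv => ih _ _ (lengthLE_mono hn' hv)
        · rw [actionFuel_succ_self (n + 1) hu hi, actionFuel_succ_self n hu hi, ih _ _ hmem]

theorem actionFuel_eq_of_le {m n : ℕ} (hmn : m ≤ n) (x : L) (v : Word z →₀ k)
    (hv : v ∈ lengthLE z m) : actionFuel z n x v = actionFuel z m x v := by
  induction n, hmn using Nat.le_induction with
  | base => rfl
  | succ n hn ih => rw [actionFuel_succ_eq n _ _ (lengthLE_mono hn hv), ih]

/-! ### The action and its recursion rules -/

variable (z) in
/-- The action of `L` on the space spanned by the admissible words. -/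
noncomputable def action : L →ₗ[k] (Word z →₀ k) →ₗ[k] (Word z →₀ k) :=
  LinearMap.flip (linearCombination k fun w : Word z =>
    (actionFuel z w.1.length).flip (single w 1))

theorem action_eq_actionFuel {n : ℕ} (x : L) {v : Word z →₀ k} (hv : v ∈ lengthLE z n) :
    action z x v = actionFuel z n x v := by
  refine lengthLE_le (N := LinearMap.eqLocus (action z x) (actionFuel z n x)) ?_ hv
  intro w hw hn
  rw [LinearMap.mem_eqLocus, actionFuel_eq_of_le hn _ _ (single_mem_lengthLE hw le_rfl)]
  simp [action]

theorem action_of_isAdmissible {i : ι} {w : List ι} (hw : IsAdmissible z w)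
    (h : IsAdmissible z (i :: w)) :
    action z (z i) (single ⟨w, hw⟩ 1) = single ⟨i :: w, h⟩ 1 := by
  rw [action_eq_actionFuel _ (single_mem_lengthLE hw le_rfl), actionFuel_of_isAdmissible _ _ h]

theorem action_mem_leading {i l : ι} {w : List ι} (hw : IsAdmissible z w)
    (hl : IsAdmissible z (l :: w)) (hli : l < i) :
    action z (z i) (single ⟨w, hw⟩ 1) ∈ leading z l w.length := by
  rw [action_eq_actionFuel _ (single_mem_lengthLE hw le_rfl)]
  exact actionFuel_mem_leading _ hw hl hli

theorem action_self {i : ι} {w : List ι} (hw : IsAdmissible z (i :: w)) (hi : parity z i = 1) :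
    action z (z i) (single ⟨i :: w, hw⟩ 1) =
      (1 / 2 : k) • action z (bracket (k := k) (z i) (z i)) (single ⟨w, hw.tail⟩ 1) := by
  rw [action_eq_actionFuel _ (single_mem_lengthLE hw le_rfl),
    action_eq_actionFuel _ (single_mem_lengthLE hw.tail le_rfl)]
  exact actionFuel_succ_self _ hw hi

theorem action_of_lt {i j : ι} {w : List ι} (hw : IsAdmissible z (j :: w)) (hij : j < i) :
    action z (z i) (single ⟨j :: w, hw⟩ 1) =
      superSign k (parity z i) (parity z j) •
          action z (z j) (action z (z i) (single ⟨w, hw.tail⟩ 1)) +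
        action z (bracket (k := k) (z i) (z j)) (single ⟨w, hw.tail⟩ 1) := by
  have hmem := single_mem_lengthLE (k := k) hw.tail le_rfl
  rw [action_eq_actionFuel _ (single_mem_lengthLE hw le_rfl), action_eq_actionFuel _ hmem,
    action_eq_actionFuel _ hmem]
  refine (actionFuel_succ_of_lt w.length hw hij).trans ?_
  congr 2
  -- The argument of `z j` may have length `w.length + 1`, beyond the fuel, but its longest words
  -- simply receive `j` in front.
  refine leading_le (N := LinearMap.eqLocus (actionFuel z w.length (z j)) (action z (z j)))
    ?_ ?_ (actionFuel_mem_leading _ hw.tail hw hij)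
  · intro v hv hjv
    rw [LinearMap.mem_eqLocus, actionFuel_of_isAdmissible _ _ hjv, action_of_isAdmissible _ hjv]
  · exact fun v hv => (action_eq_actionFuel _ hv).symm

end Action

/-! ### Homogeneous vectors and consequences of the Jacobi identity -/

section Commutation

variable {k L ι : Type*} [Field k] [AddCommGroup L] [Module k L] [LieSuperalgebra k L]

theorem disjoint_part {a b : ZMod 2} (h : a ≠ b) :
    Disjoint (part (k := k) (L := L) a) (part (k := k) (L := L) b) :=
  (isInternal (k := k) (L := L)).submodule_iSupIndep.pairwiseDisjoint h

theorem mem_part_parity {z : Module.Basis ι k L}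
    (hz : ∀ i, ∃ a : ZMod 2, z i ∈ part (k := k) (L := L) a) (i : ι) :
    z i ∈ part (k := k) (L := L) (parity z i) := by
  by_cases h : z i ∈ part (k := k) (L := L) 1
  · simp [parity, h]
  · obtain ⟨a, ha⟩ := hz i
    rcases parity_cases a with rfl | rfl
    · simpa [parity, h] using ha
    · exact absurd ha h

/-- A homogeneous vector is a combination of basis vectors of its parity. -/
theorem mem_of_parity_basis_mem {z : Module.Basis ι k L}
    (hz : ∀ i, ∃ a : ZMod 2, z i ∈ part (k := k) (L := L) a) {a : ZMod 2} {x : L}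
    (hx : x ∈ part (k := k) (L := L) a) {N : Submodule k L}
    (h : ∀ i, parity z i = a → z i ∈ N) : x ∈ N := by
  -- Each basis vector lies in one of the two summands. For homogeneous `x` the component of the
  -- other parity then lies in both parts, hence is zero.
  have key : ∀ y : L, y ∈ (part (k := k) (L := L) a ⊓ N) ⊔ part (k := k) (L := L) (a + 1) := by
    refine mem_of_basis_mem (z := z) fun i => ?_
    by_cases hi : parity z i = a
    · exact Submodule.mem_sup_left ⟨hi ▸ mem_part_parity hz i, h i hi⟩
    · have : parity z i = a + 1 := by
        rcases parity_cases a with rfl | rfl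
        · simpa [hi] using parity_cases (parity z i)
        · simpa [hi, one_add_one_parity] using parity_cases (parity z i)
      exact Submodule.mem_sup_right (this ▸ mem_part_parity hz i)
  obtain ⟨u, ⟨hu, huN⟩, v, hv, rfl⟩ := Submodule.mem_sup.1 (key x)
  have hv' : v ∈ part (k := k) (L := L) a := by simpa using sub_mem hx hu
  have : v = 0 := Submodule.disjoint_def.1
    (disjoint_part (k := k) (L := L) (a := a) (b := a + 1) (by simp)) v hv' hv
  simpa [this] using huN

theorem bracket_self_of_even (hk2 : ringChar k ≠ 2) {x : L} (hx : x ∈ part (k := k) (L := L) 0) :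
    bracket (k := k) x x = 0 := by
  have h := bracket_skew 0 0 x x hx hx
  rw [superSign_zero_left, one_smul] at h
  have h2 : (2 : k) • bracket (k := k) x x = 0 := by
    rw [two_smul]
    exact eq_neg_iff_add_eq_zero.1 h
  exact (smul_eq_zero.1 h2).resolve_left (Ring.two_ne_zero hk2)

/-- Jacobi for `x, x, x` together with skew-symmetry gives three times this bracket equal to zero.
-/
theorem bracket_bracket_self_of_odd (hk3 : ringChar k ≠ 3) {x : L}
    (hx : x ∈ part (k := k) (L := L) 1) :
    bracket (k := k) x (bracket (k := k) x x) = 0 := by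
  have hxx : bracket (k := k) x x ∈ part (k := k) (L := L) 0 := bracket_mem 1 1 x x hx hx
  have h := jacobi 1 1 1 x x x hx hx hx
  have h' := bracket_skew 0 1 _ x hxx hx
  rw [superSign_one_one] at h
  rw [superSign_zero_left, one_smul] at h'
  rw [h'] at h
  have h3 : (3 : k) • bracket (k := k) x (bracket (k := k) x x) = 0 := by
    linear_combination (norm := module) h
  exact (smul_eq_zero.1 h3).resolve_left (three_ne_zero_of_ringChar hk3)

/-- The bracket with a square of an odd vector. -/
theorem bracket_bracket_odd {a : ZMod 2} {x y : L} (hx : x ∈ part (k := k) (L := L) a)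
    (hy : y ∈ part (k := k) (L := L) 1) :
    bracket (k := k) x (bracket (k := k) y y) =
      (2 : k) • bracket (k := k) (bracket (k := k) x y) y := by
  have h := jacobi a 1 1 x y y hx hy hy
  have h' := bracket_skew 1 (a + 1) y _ hy (bracket_mem a 1 x y hx hy)
  rw [h'] at h
  rcases parity_cases a with rfl | rfl
  · rw [zero_add, superSign_one_one, superSign_zero_left] at h
    linear_combination (norm := module) h
  · rw [one_add_one_parity, superSign_one_one, superSign_zero_right] at h
    linear_combination (norm := module) h

/-! ### The action respects the bracket -/

variable [LinearOrder ι]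

variable {z : Module.Basis ι k L}

variable (z) in
/-- The failure of the action to respect the bracket of vectors `x`, `y` of parities `a`, `b`. -/
noncomputable def defect (a b : ZMod 2) (x y : L) : (Word z →₀ k) →ₗ[k] (Word z →₀ k) :=
  action z x ∘ₗ action z y - superSign k a b • (action z y ∘ₗ action z x) -
    action z (bracket (k := k) x y)

theorem defect_eq_zero_iff {a b : ZMod 2} {x y : L} {v : Word z →₀ k} :
    defect z a b x y v = 0 ↔ action z x (action z y v) =
      superSign k a b • action z y (action z x v) + action z (bracket (k := k) x y) v := by
  simp [defect, sub_sub, sub_eq_zero]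

theorem defect_eq_zero_of_basis
    (hz : ∀ i, ∃ a : ZMod 2, z i ∈ part (k := k) (L := L) a) {v : Word z →₀ k}
    (h : ∀ i j, defect z (parity z i) (parity z j) (z i) (z j) v = 0) {a b : ZMod 2} {x y : L}
    (hx : x ∈ part (k := k) (L := L) a) (hy : y ∈ part (k := k) (L := L) b) :
    defect z a b x y v = 0 := by
  have h1 (i : ι) : defect z (parity z i) b (z i) y v = 0 := by
    -- With the parities fixed the sign is constant, so the defect at `v` is linear in each
    -- argument.
    refine mem_of_parity_basis_mem hz hy (N := LinearMap.ker
      (action z (z i) ∘ₗ (action z).flip v -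
        superSign k (parity z i) b • (action z).flip (action z (z i) v) -
        (action z).flip v ∘ₗ bracket (k := k) (z i))) ?_
    rintro j rfl
    exact h i j
  refine mem_of_parity_basis_mem hz hx (N := LinearMap.ker
      ((action z).flip (action z y v) -
        superSign k a b • (action z y ∘ₗ (action z).flip v) -
        (action z).flip v ∘ₗ (bracket (k := k)).flip y)) ?_
  rintro i rfl
  exact h1 i

theorem defect_symm {a b : ZMod 2} {x y : L} (hx : x ∈ part (k := k) (L := L) a)
    (hy : y ∈ part (k := k) (L := L) b) {v : Word z →₀ k} (h : defect z a b x y v = 0) :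
    defect z b a y x v = 0 := by
  rw [defect_eq_zero_iff] at h ⊢
  rw [bracket_skew b a y x hy hx, h, map_neg, map_smul]
  rcases parity_cases a with rfl | rfl <;> rcases parity_cases b with rfl | rfl <;>
    simp only [superSign_zero_left, superSign_zero_right, superSign_one_one,
      LinearMap.neg_apply, LinearMap.smul_apply] <;> module

theorem defect_self_of_even (hk2 : ringChar k ≠ 2) {x : L} (hx : x ∈ part (k := k) (L := L) 0)
    (v : Word z →₀ k) : defect z 0 0 x x v = 0 := by
  rw [defect_eq_zero_iff, bracket_self_of_even hk2 hx, superSign_zero_left]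
  simp

theorem defect_one_one_iff (hk2 : ringChar k ≠ 2) {y : L} {v : Word z →₀ k} :
    defect z 1 1 y y v = 0 ↔ action z y (action z y v) =
      (1 / 2 : k) • action z (bracket (k := k) y y) v := by
  have h2 : (2 : k) ≠ 0 := Ring.two_ne_zero hk2
  rw [defect_eq_zero_iff, superSign_one_one]
  constructor
  · intro h
    have : (1 / 2 : k) • (2 : k) • action z y (action z y v) =
        (1 / 2 : k) • action z (bracket (k := k) y y) v := by
      congr 1
      linear_combination (norm := module) h
    rwa [smul_smul, one_div_mul_cancel h2, one_smul] at this
  · intro h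
    have : action z (bracket (k := k) y y) v = (2 : k) • action z y (action z y v) := by
      rw [h, smul_smul, mul_one_div_cancel h2, one_smul]
    rw [this]
    module

/-- The defect vanishes if one of the two letters may be put in front of the word. -/
theorem defect_single_of_isAdmissible (hk2 : ringChar k ≠ 2)
    (hz : ∀ i, ∃ a : ZMod 2, z i ∈ part (k := k) (L := L) a) {i j : ι} (hji : j ≤ i)
    {w : List ι} (hw : IsAdmissible z w) (h : IsAdmissible z (j :: w)) :
    defect z (parity z i) (parity z j) (z i) (z j) (single ⟨w, hw⟩ 1) = 0 := by
  rcases hji.lt_or_eq with hji | rfl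
  · rw [defect_eq_zero_iff, action_of_isAdmissible _ h, action_of_lt h hji]
  · have hp := mem_part_parity hz j
    rcases parity_cases (parity z j) with hj | hj
    · rw [hj] at hp ⊢
      exact defect_self_of_even hk2 hp _
    · rw [hj, defect_one_one_iff hk2, action_of_isAdmissible _ h, action_self h hj]

/-- On words that accept `l` the defect vanishes by construction of the action; the short words are
left to the induction hypothesis. -/
theorem defect_of_mem_leading (hk2 : ringChar k ≠ 2)
    (hz : ∀ i, ∃ a : ZMod 2, z i ∈ part (k := k) (L := L) a) {i l : ι} (hli : l ≤ i) {n : ℕ}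
    (h : ∀ v ∈ lengthLE z n, defect z (parity z i) (parity z l) (z i) (z l) v = 0)
    {v : Word z →₀ k} (hv : v ∈ leading z l n) :
    defect z (parity z i) (parity z l) (z i) (z l) v = 0 :=
  leading_le (N := LinearMap.ker (defect z (parity z i) (parity z l) (z i) (z l)))
    (fun _ hw hl => defect_single_of_isAdmissible hk2 hz hli hw hl) h hv

/-- The Jacobi identity moves the vanishing of the defect from `u` to `t u`. -/
theorem defect_action_of_jacobi {a b c : ZMod 2} {x y t : L}
    (hx : x ∈ part (k := k) (L := L) a) (hy : y ∈ part (k := k) (L := L) b)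
    (ht : t ∈ part (k := k) (L := L) c) {u : Word z →₀ k}
    (hu : ∀ (a b : ZMod 2) (x y : L), x ∈ part (k := k) (L := L) a →
      y ∈ part (k := k) (L := L) b → defect z a b x y u = 0)
    (h1 : defect z a c x t (action z y u) = 0) (h2 : defect z b c y t (action z x u) = 0) :
    defect z a b x y (action z t u) = 0 := by
  -- On both sides `t` is moved to the left past `x` and `y`. What remains is `t` applied to the
  -- relation for `x`, `y` on `u`, and brackets that match by Jacobi.
  rw [defect_eq_zero_iff] at h1 h2 ⊢
  have e1 := defect_eq_zero_iff.1 (hu b c y t hy ht)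
  have e2 := defect_eq_zero_iff.1 (hu a c x t hx ht)
  have e3 := defect_eq_zero_iff.1 (hu a b x y hx hy)
  have e4 := defect_eq_zero_iff.1 (hu a (b + c) x _ hx (bracket_mem b c y t hy ht))
  have e5 := defect_eq_zero_iff.1 (hu b (a + c) y _ hy (bracket_mem a c x t hx ht))
  have e6 := defect_eq_zero_iff.1 (hu (a + b) c _ t (bracket_mem a b x y hx hy) ht)
  rw [jacobi a b c x y t hx hy ht] at e4
  rw [e1, e2, e6, map_add, map_add, map_smul, map_smul, h1, h2, e3, e4, e5]
  simp only [map_add, map_smul, LinearMap.add_apply, LinearMap.smul_apply]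
  rcases parity_cases a with rfl | rfl <;> rcases parity_cases b with rfl | rfl <;>
    rcases parity_cases c with rfl | rfl <;>
    simp only [superSign_zero_left, superSign_zero_right, superSign_one_one, add_zero, zero_add,
      one_add_one_parity] <;> module

/-- With `t = y` the argument of `defect_action_of_jacobi` would be circular, its first hypothesis
being the claim. Instead `y y` is replaced by `[y,y]/2`, on `u` and on `x u`, and `[x,[y,y]] =
2[[x,y],y]` closes the computation. -/
theorem defect_action_of_odd (hk2 : ringChar k ≠ 2) {a : ZMod 2} {x y : L}
    (hx : x ∈ part (k := k) (L := L) a) (hy : y ∈ part (k := k) (L := L) 1) {u : Word z →₀ k}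
    (hu : ∀ (a b : ZMod 2) (x y : L), x ∈ part (k := k) (L := L) a →
      y ∈ part (k := k) (L := L) b → defect z a b x y u = 0)
    (h : defect z 1 1 y y (action z x u) = 0) :
    defect z a 1 x y (action z y u) = 0 := by
  have h2 : (2 : k) ≠ 0 := Ring.two_ne_zero hk2
  rw [defect_one_one_iff hk2] at h
  rw [defect_eq_zero_iff]
  have e1 := (defect_one_one_iff hk2).1 (hu 1 1 y y hy hy)
  have e2 := defect_eq_zero_iff.1 (hu a 1 x y hx hy)
  have e3 := defect_eq_zero_iff.1 (hu a 0 x _ hx (bracket_mem 1 1 y y hy hy))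
  have e4 := defect_eq_zero_iff.1 (hu (a + 1) 1 _ y (bracket_mem a 1 x y hx hy) hy)
  rw [bracket_bracket_odd hx hy, superSign_zero_right, one_smul, map_smul,
    LinearMap.smul_apply] at e3
  rw [e1, map_smul, e3, e2, map_add, map_smul, h, e4, smul_add, smul_smul (1 / 2 : k),
    one_div_mul_cancel h2]
  rcases parity_cases a with rfl | rfl <;>
    simp only [superSign_zero_left, superSign_one_one, zero_add, one_add_one_parity] <;> module

/-- Since `y y u = [y,y] u / 2`, it suffices that `y` commutes with `[y,y]` on `u`, which follows
from `[y,[y,y]] = 0`. -/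
theorem defect_action_of_odd_self (hk2 : ringChar k ≠ 2) (hk3 : ringChar k ≠ 3) {y : L}
    (hy : y ∈ part (k := k) (L := L) 1) {u : Word z →₀ k}
    (hu : ∀ (a b : ZMod 2) (x y : L), x ∈ part (k := k) (L := L) a →
      y ∈ part (k := k) (L := L) b → defect z a b x y u = 0) :
    defect z 1 1 y y (action z y u) = 0 := by
  rw [defect_one_one_iff hk2]
  have e1 := (defect_one_one_iff hk2).1 (hu 1 1 y y hy hy)
  have e2 := defect_eq_zero_iff.1 (hu 1 0 y _ hy (bracket_mem 1 1 y y hy hy))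
  rw [bracket_bracket_self_of_odd hk3 hy, superSign_zero_right, one_smul, map_zero,
    LinearMap.zero_apply, add_zero] at e2
  rw [e1, map_smul, e2]

/-- The action of `L` on the span of the admissible words respects the bracket. -/
theorem defect_eq_zero (hk2 : ringChar k ≠ 2) (hk3 : ringChar k ≠ 3)
    (hz : ∀ i, ∃ a : ZMod 2, z i ∈ part (k := k) (L := L) a) {a b : ZMod 2} {x y : L}
    (hx : x ∈ part (k := k) (L := L) a) (hy : y ∈ part (k := k) (L := L) b)
    (v : Word z →₀ k) : defect z a b x y v = 0 := by
  have hp := mem_part_parity hz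
  have key (n : ℕ) : ∀ v ∈ lengthLE z n, ∀ i j,
      defect z (parity z i) (parity z j) (z i) (z j) v = 0 := by
    induction n with
    | zero =>
      intro v hv i j
      refine lengthLE_le (N := LinearMap.ker _) (fun w hw hn => ?_) hv
      obtain rfl : w = [] := by simpa using hn
      rw [LinearMap.mem_ker]
      rcases le_total j i with h | h
      · exact defect_single_of_isAdmissible hk2 hz h hw (isAdmissible_singleton j)
      · exact defect_symm (hp j) (hp i)
          (defect_single_of_isAdmissible hk2 hz h hw (isAdmissible_singleton i))
    | succ n ih =>
      have main : ∀ (w : List ι) (hw : IsAdmissible z w), w.length ≤ n + 1 → ∀ i j, j ≤ i →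
          defect z (parity z i) (parity z j) (z i) (z j) (single ⟨w, hw⟩ 1) = 0 := by
        intro w hw hn i j hji
        by_cases h : IsAdmissible z (j :: w)
        · exact defect_single_of_isAdmissible hk2 hz hji hw h
        match w, hw, h, hn with
        | [], _, h, _ => exact absurd (isAdmissible_singleton j) h
        | l :: u, hu, h, hn =>
          have hn' : u.length ≤ n := by simpa using hn
          have hbasis : ∀ v ∈ lengthLE z u.length, ∀ i j,
              defect z (parity z i) (parity z j) (z i) (z j) v = 0 :=
            fun v hv => ih v (lengthLE_mono hn' hv)
          have hall : ∀ (a b : ZMod 2) (x y : L), x ∈ part (k := k) (L := L) a →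
              y ∈ part (k := k) (L := L) b →
              defect z a b x y (single ⟨u, hu.tail⟩ 1) = 0 := fun a b x y hx hy =>
            defect_eq_zero_of_basis hz (hbasis _ (single_mem_lengthLE _ le_rfl)) hx hy
          have hlead {i m : ι} (hi : l < i) (hm : l < m) :
              defect z (parity z i) (parity z l) (z i) (z l)
                (action z (z m) (single ⟨u, hu.tail⟩ 1)) = 0 :=
            defect_of_mem_leading hk2 hz hi.le (fun v hv => hbasis v hv i l)
              (action_mem_leading _ hu hm)
          -- The word `l u` is viewed as `z l` acting on `u`, where all defects vanish by induction.
          rw [← action_of_isAdmissible hu.tail hu]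
          rcases lt_or_eq_of_not_isAdmissible hu h with hlj | ⟨rfl, hj⟩
          · exact defect_action_of_jacobi (hp i) (hp j) (hp l) hall
              (hlead (hlj.trans_le hji) hlj) (hlead hlj (hlj.trans_le hji))
          · have hpj := hp j
            rw [hj] at hpj ⊢
            rcases hji.lt_or_eq with hji | rfl
            -- As `j < i`, the longest words in `z i` applied to `u` accept `j` in front, so the
            -- defect of `z j` with itself vanishes there.
            · refine defect_action_of_odd hk2 (hp i) hpj hall ?_
              have := defect_of_mem_leading hk2 hz (le_refl j) (fun v hv => hbasis v hv j j)
                (action_mem_leading hu.tail hu hji)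
              rwa [hj] at this
            · rw [hj]
              exact defect_action_of_odd_self hk2 hk3 hpj hall
      intro v hv i j
      refine lengthLE_le (N := LinearMap.ker _) (fun w hw hn => ?_) hv
      rw [LinearMap.mem_ker]
      rcases le_total j i with h | h
      · exact main w hw hn i j h
      · exact defect_symm (hp j) (hp i) (main w hw hn j i h)
  refine LinearMap.congr_fun (g := 0) (Finsupp.lhom_ext' fun w => LinearMap.ext_ring ?_) v
  exact defect_eq_zero_of_basis hz (key _ _ (single_mem_lengthLE w.2 le_rfl)) hx hy

end Commutation

/-! ### Comparison with the enveloping algebra -/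

section Monomials

variable {k L ι : Type*} [Field k] [AddCommGroup L] [Module k L] [LieSuperalgebra k L]
  [LinearOrder ι] {z : Module.Basis ι k L}

theorem toEnveloping_mul {a b : ZMod 2} {x y : L} (hx : x ∈ part (k := k) (L := L) a)
    (hy : y ∈ part (k := k) (L := L) b) :
    toEnveloping k L x * toEnveloping k L y =
      superSign k a b • (toEnveloping k L y * toEnveloping k L x) +
        toEnveloping k L (bracket (k := k) x y) := by
  have h := RingQuot.mkAlgHom_rel k (EnvelopingRel.of a b x y hx hy)
  rw [map_sub, map_smul, map_mul, map_mul] at h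
  exact sub_eq_iff_eq_add'.1 h

variable (z) in
/-- The linear map from the span of the admissible words to the enveloping algebra that sends a
word to the corresponding monomial. -/
noncomputable def monomialMap : (Word z →₀ k) →ₗ[k] Enveloping k L :=
  linearCombination k fun w => (w.1.map fun i => toEnveloping k L (z i)).prod

theorem monomialMap_single {w : List ι} (hw : IsAdmissible z w) :
    monomialMap z (single ⟨w, hw⟩ 1) = (w.map fun i => toEnveloping k L (z i)).prod := by
  simp [monomialMap]

/-- Every rule defining the action is an identity in the enveloping algebra. The induction on length
meets the nested call of the swap rule again, and `action_mem_leading` handles it as before. -/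
theorem monomialMap_action (hk2 : ringChar k ≠ 2)
    (hz : ∀ i, ∃ a : ZMod 2, z i ∈ part (k := k) (L := L) a) (x : L) (v : Word z →₀ k) :
    monomialMap z (action z x v) = toEnveloping k L x * monomialMap z v := by
  have hp := mem_part_parity hz
  have h2 : (2 : k) ≠ 0 := Ring.two_ne_zero hk2
  let D₁ : L →ₗ[k] (Word z →₀ k) →ₗ[k] Enveloping k L := (action z).compr₂ (monomialMap z)
  let D₂ : L →ₗ[k] (Word z →₀ k) →ₗ[k] Enveloping k L :=
    ((LinearMap.mul k (Enveloping k L)).comp (toEnveloping k L)).compl₂ (monomialMap z)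
  have hD {x : L} {v : Word z →₀ k} : D₁ x v = D₂ x v ↔
      monomialMap z (action z x v) = toEnveloping k L x * monomialMap z v := by
    simp [D₁, D₂]
  have hcons {i : ι} {w : List ι} (hw : IsAdmissible z w) (h : IsAdmissible z (i :: w)) :
      D₁ (z i) (single ⟨w, hw⟩ 1) = D₂ (z i) (single ⟨w, hw⟩ 1) := by
    rw [hD, action_of_isAdmissible _ h, monomialMap_single, monomialMap_single, List.map_cons,
      List.prod_cons]
  have key (n : ℕ) : ∀ v ∈ lengthLE z n, ∀ x, D₁ x v = D₂ x v := by
    have reduce (n : ℕ) (h : ∀ (w : List ι) (hw : IsAdmissible z w), w.length ≤ n → ∀ i,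
        D₁ (z i) (single ⟨w, hw⟩ 1) = D₂ (z i) (single ⟨w, hw⟩ 1)) :
        ∀ v ∈ lengthLE z n, ∀ x, D₁ x v = D₂ x v := fun v hv x =>
      mem_of_basis_mem (z := z) (N := LinearMap.eqLocus (D₁.flip v) (D₂.flip v)) (fun i =>
        lengthLE_le (N := LinearMap.eqLocus (D₁ (z i)) (D₂ (z i))) (fun w hw hn => h w hw hn i) hv) x
    induction n with
    | zero =>
      refine reduce 0 fun w hw hn i => ?_
      obtain rfl : w = [] := by simpa using hn
      exact hcons hw (isAdmissible_singleton i)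
    | succ n ih =>
      refine reduce (n + 1) fun w hw hn i => ?_
      by_cases h : IsAdmissible z (i :: w)
      · exact hcons hw h
      match w, hw, h, hn with
      | [], _, h, _ => exact absurd (isAdmissible_singleton i) h
      | j :: u, hu, h, hn =>
        have hn' : u.length ≤ n := by simpa using hn
        have hu' (x : L) := hD.1 (ih _ (single_mem_lengthLE hu.tail hn') x)
        have hmon : monomialMap z (single ⟨j :: u, hu⟩ 1) =
            toEnveloping k L (z j) * monomialMap z (single ⟨u, hu.tail⟩ 1) := by
          rw [monomialMap_single, monomialMap_single, List.map_cons, List.prod_cons]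
        rw [hD, hmon, ← mul_assoc, toEnveloping_mul (hp i) (hp j)]
        rcases lt_or_eq_of_not_isAdmissible hu h with hji | ⟨rfl, hi⟩
        · have hlead : D₁ (z j) (action z (z i) (single ⟨u, hu.tail⟩ 1)) =
              D₂ (z j) (action z (z i) (single ⟨u, hu.tail⟩ 1)) :=
            leading_le (N := LinearMap.eqLocus (D₁ (z j)) (D₂ (z j))) (fun _ hw hl => hcons hw hl)
              (fun v hv => ih v (lengthLE_mono hn' hv) _) (action_mem_leading hu.tail hu hji)
          rw [action_of_lt hu hji, map_add, map_smul, hD.1 hlead, hu', hu', add_mul,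
            smul_mul_assoc, mul_assoc]
        · have hpi := hp i
          rw [hi] at hpi
          have hrel := toEnveloping_mul hpi hpi
          rw [superSign_one_one] at hrel
          -- The expansion made before the case split is undone, because here the square itself is
          -- compared with half the bracket.
          rw [← toEnveloping_mul (hp i) (hp i), action_self hu hi, map_smul, hu',
            ← smul_mul_assoc]
          congr 1
          have : toEnveloping k L (bracket (k := k) (z i) (z i)) =
              (2 : k) • (toEnveloping k L (z i) * toEnveloping k L (z i)) := by
            linear_combination (norm := module) -hrel
          rw [this, smul_smul, one_div_mul_cancel h2, one_smul]
  refine hD.1 (LinearMap.congr_fun (Finsupp.lhom_ext' fun w => LinearMap.ext_ring ?_) v)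
  exact key _ _ (single_mem_lengthLE w.2 le_rfl) x

/-- A subspace of the enveloping algebra that contains `1` and is stable under left multiplication
by `L` is everything. -/
theorem mem_of_one_mem_of_mul_mem {N : Submodule k (Enveloping k L)} (h1 : 1 ∈ N)
    (hmul : ∀ (x : L), ∀ u ∈ N, toEnveloping k L x * u ∈ N) (u : Enveloping k L) : u ∈ N := by
  obtain ⟨t, rfl⟩ := RingQuot.mkAlgHom_surjective k (EnvelopingRel k L) u
  have key : ∀ v ∈ N, RingQuot.mkAlgHom k (EnvelopingRel k L) t * v ∈ N := by
    induction t using TensorAlgebra.induction with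
    | algebraMap r =>
      intro v hv
      rw [AlgHom.commutes, ← Algebra.smul_def]
      exact N.smul_mem r hv
    | ι x => exact hmul x
    | mul a b ha hb =>
      intro v hv
      rw [map_mul, mul_assoc]
      exact ha _ (hb v hv)
    | add a b ha hb =>
      intro v hv
      rw [map_add, add_mul]
      exact N.add_mem (ha v hv) (hb v hv)
  simpa using key 1 h1

variable (z) in
/-- The action of the enveloping algebra on the span of the admissible words. -/
noncomputable def envelopingAction (hk2 : ringChar k ≠ 2) (hk3 : ringChar k ≠ 3)
    (hz : ∀ i, ∃ a : ZMod 2, z i ∈ part (k := k) (L := L) a) :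
    Enveloping k L →ₐ[k] Module.End k (Word z →₀ k) :=
  RingQuot.liftAlgHom k ⟨TensorAlgebra.lift k (action z), by
    rintro _ _ ⟨a, b, x, y, hx, hy⟩
    refine LinearMap.ext fun v => ?_
    have h := defect_eq_zero_iff.1 (defect_eq_zero hk2 hk3 hz hx hy v)
    simp only [map_sub, map_smul, map_mul, TensorAlgebra.lift_ι_apply, LinearMap.sub_apply,
      LinearMap.smul_apply, Module.End.mul_apply]
    exact sub_eq_iff_eq_add'.2 h⟩

theorem envelopingAction_toEnveloping (hk2 : ringChar k ≠ 2) (hk3 : ringChar k ≠ 3)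
    (hz : ∀ i, ∃ a : ZMod 2, z i ∈ part (k := k) (L := L) a) (x : L) :
    envelopingAction z hk2 hk3 hz (toEnveloping k L x) = action z x := by
  simp [envelopingAction, toEnveloping]

theorem envelopingAction_monomial (hk2 : ringChar k ≠ 2) (hk3 : ringChar k ≠ 3)
    (hz : ∀ i, ∃ a : ZMod 2, z i ∈ part (k := k) (L := L) a) {w : List ι}
    (hw : IsAdmissible z w) :
    envelopingAction z hk2 hk3 hz (w.map fun i => toEnveloping k L (z i)).prod
      (single ⟨[], isAdmissible_nil z⟩ 1) = single ⟨w, hw⟩ 1 := by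
  induction w with
  | nil => simp
  | cons i w ih =>
    rw [List.map_cons, List.prod_cons, map_mul, Module.End.mul_apply, ih hw.tail,
      envelopingAction_toEnveloping, action_of_isAdmissible _ hw]

/-- Evaluating the enveloping action at the empty word is a left inverse; surjectivity holds because
the range contains `1` and is stable under left multiplication by `L`. -/
theorem monomialMap_bijective (hk2 : ringChar k ≠ 2) (hk3 : ringChar k ≠ 3)
    (hz : ∀ i, ∃ a : ZMod 2, z i ∈ part (k := k) (L := L) a) :
    Function.Bijective (monomialMap z) := by
  constructor
  · let E : Enveloping k L →ₗ[k] (Word z →₀ k) :=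
      (envelopingAction z hk2 hk3 hz).toLinearMap.flip (single ⟨[], isAdmissible_nil z⟩ 1)
    have hE : E ∘ₗ monomialMap z = LinearMap.id := by
      refine Finsupp.lhom_ext' fun w => LinearMap.ext_ring ?_
      change E (monomialMap z (single ⟨w.1, w.2⟩ 1)) = single w 1
      rw [monomialMap_single]
      exact envelopingAction_monomial hk2 hk3 hz w.2
    exact Function.LeftInverse.injective (g := E) fun v => LinearMap.congr_fun hE v
  · intro u
    refine mem_of_one_mem_of_mul_mem (N := LinearMap.range (monomialMap z)) ?_ ?_ u
    · exact ⟨single ⟨[], isAdmissible_nil z⟩ 1, by rw [monomialMap_single]; rfl⟩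
    · rintro x _ ⟨v, rfl⟩
      exact ⟨action z x v, monomialMap_action hk2 hz x v⟩

end Monomials

end LieSuperalgebra

theorem mainTheorem3 {k L ι : Type*} [Field k] (hk2 : ringChar k ≠ 2) (hk3 : ringChar k ≠ 3)
    [AddCommGroup L] [Module k L] [LieSuperalgebra k L] [LinearOrder ι]
    (z : Module.Basis ι k L)
    (hz : ∀ i, ∃ a : ZMod 2, z i ∈ LieSuperalgebra.part (k := k) (L := L) a) :
    ∃ B : Module.Basis {w : List ι // LieSuperalgebra.IsAdmissible z w} k
        (LieSuperalgebra.Enveloping k L),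
      ∀ w : {w : List ι // LieSuperalgebra.IsAdmissible z w},
        B w = (w.1.map fun i => LieSuperalgebra.toEnveloping k L (z i)).prod := by
  refine ⟨Module.Basis.ofRepr (LinearEquiv.ofBijective (LieSuperalgebra.monomialMap z)
    (LieSuperalgebra.monomialMap_bijective hk2 hk3 hz)).symm, fun w => ?_⟩
  exact LieSuperalgebra.monomialMap_single w.2
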